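/- Let $f_1,\dots,f_n:\mathbb{R}^N\to\mathbb{R}$ ($n\ge 1$) be differentiable, convex and $L$-smooth with $L>0$, i.e. $\langle\nabla f_i(x)-\nabla f_i(y),\,x-y\rangle\ge\frac1L\|\nabla f_i(x)-\nabla f_i(y)\|^2$ for all $x,y\in\mathbb{R}^N$, and assume that $F=\frac1n\sum_{i=1}^n f_i$ has a minimizer. Let $x^0,y_1^0,\dots,y_n^0\in\mathbb{R}^N$, $\lambda>0$ and $\theta\in\mathbb{R}$. SVAG generates random sequences $x^k$, $y_1^k,\dots,y_n^k$ as follows: for $k=0,1,\dots$, sample $i_k$ uniformly from $\{1,\dots,n\}$, independently over the iterations, and set $$x^{k+1}=x^k-\lambda\Big[\tfrac{\theta}{n}\big(\nabla f_{i_k}(x^k)-y_{i_k}^k\big)+\tfrac1n\sum_{j=1}^n y_j^k\Big],\qquad y_{i_k}^{k+1}=\nabla f_{i_k}(x^k),\qquad y_j^{k+1}=y_j^k\ \text{ for } j\ne i_k.$$ If $\theta\le n$ and $$\lambda<\frac1L\cdot\frac{1}{2+(n-\theta)\frac{\theta-1}{n}\Big(\frac{\theta-1}{n}-1+\operatorname{sign}(\theta-1)\sqrt2\Big)},$$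 then there is a random variable $x^\star$ with values in $\mathbb{R}^N$ such that, almost surely, $x^\star$ is a minimizer of $F$, $x^k\to x^\star$, $y_i^k\to\nabla f_i(x^\star)$ for every $i$, and, as $k\to\infty$, $$\min_{0\le t\le k}\|\nabla f_i(x^t)-\nabla f_i(x^\star)\|^2=\mathcal{O}(1/k),\qquad \min_{0\le t\le k}\|y_i^t-\nabla f_i(x^\star)\|^2=\mathcal{O}(1/k)\qquad\text{for every } i,$$ $$\min_{0\le t\le k}F(x^t)-F(x^\star)=\mathcal{O}(1/k).$$ (The constants in $\mathcal{O}$ may depend on the realization.) For $\theta=1$ (SAG) and for $\theta=n$ (SAGA) the upper bound on $\lambda$ equals $\frac{1}{2L}$. -/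

import Mathlib

open MeasureTheory ProbabilityTheory Filter Topology Asymptotics
open scoped Gradient ENNReal

noncomputable section

/-- `R` is `c`-cocoercive on `ℝ^N` (Euclidean inner product). -/
def Cocoercive {N : ℕ} (c : ℝ)
    (R : EuclideanSpace ℝ (Fin N) → EuclideanSpace ℝ (Fin N)) : Prop :=
  ∀ x y, c * ‖R x - R y‖ ^ 2 ≤ inner ℝ (R x - R y) (x - y)

/-- A differentiable convex function is `L`-smooth if its gradient is `1/L`-cocoercive. -/
structure IsConvexSmooth {N : ℕ} (L : ℝ) (f : EuclideanSpace ℝ (Fin N) → ℝ) : Prop where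
  differentiable : Differentiable ℝ f
  convex : ConvexOn ℝ Set.univ f
  smooth : Cocoercive (1 / L) (∇ f)

/-- The finite-sum objective `F = (1/n) ∑ i, f i`. -/
def objective {N n : ℕ} (f : Fin n → EuclideanSpace ℝ (Fin N) → ℝ)
    (x : EuclideanSpace ℝ (Fin N)) : ℝ :=
  (1 / (n : ℝ)) * ∑ i, f i x

/-- One iteration of SVAG with sampled index `i`, applied to the state `(x, y)`: the current
point and the table of stored gradients. -/
def svagStep {N n : ℕ} (f : Fin n → EuclideanSpace ℝ (Fin N) → ℝ) (lam θ : ℝ) (i : Fin n)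
    (z : EuclideanSpace ℝ (Fin N) × (Fin n → EuclideanSpace ℝ (Fin N))) :
    EuclideanSpace ℝ (Fin N) × (Fin n → EuclideanSpace ℝ (Fin N)) :=
  (z.1 - lam • ((θ / (n : ℝ)) • (∇ (f i) z.1 - z.2 i) + (1 / (n : ℝ)) • ∑ j, z.2 j),
    Function.update z.2 i (∇ (f i) z.1))

/-- The SVAG iterates `(x^k, y^k)` started at `(x0, y0)`, where index `s k` is sampled in
iteration `k`. -/
def svag {N n : ℕ} (f : Fin n → EuclideanSpace ℝ (Fin N) → ℝ) (lam θ : ℝ)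
    (x0 : EuclideanSpace ℝ (Fin N)) (y0 : Fin n → EuclideanSpace ℝ (Fin N)) (s : ℕ → Fin n) :
    ℕ → EuclideanSpace ℝ (Fin N) × (Fin n → EuclideanSpace ℝ (Fin N))
  | 0 => (x0, y0)
  | k + 1 => svagStep f lam θ (s k) (svag f lam θ x0 y0 s k)

/-- The random indices `i 0, i 1, …` are independent and uniform on `Fin n`. -/
structure IsUniformSampling {Ω : Type*} [MeasurableSpace Ω] {n : ℕ} (P : Measure Ω)
    (i : ℕ → Ω → Fin n) : Prop where
  measurable : ∀ k, Measurable (i k)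
  indep : iIndepFun i P
  uniform : ∀ k j, P {ω | i k ω = j} = (n : ℝ≥0∞)⁻¹

/-- The upper bound on the step size. (The value of the sign at `θ = 1` is immaterial, as it is
multiplied by `θ - 1`.) -/
def stepSizeBound (n : ℕ) (θ L : ℝ) : ℝ :=
  1 / L * (1 / (2 + (n - θ) * ((θ - 1) / n) *
    ((θ - 1) / n - 1 + Real.sign (θ - 1) * Real.sqrt 2)))

/-- `min_{t ∈ {0,…,k}} a t`. -/
def runningMin (a : ℕ → ℝ) (k : ℕ) : ℝ :=
  (Finset.range (k + 1)).inf' Finset.nonempty_range_add_one a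

end

/-!
The proof is a Lyapunov argument followed by an almost sure convergence argument.

Write `ȳ` for the mean of the stored gradients, `D` for the difference between the fresh and the
stored gradient of the sampled index, `μ = n - θ` and `t = (θ - 1) / n`. Two auxiliary points make
one iteration transparent. The shifted iterate `x - λ μ ȳ` moves by `-λ (ȳ + D)`, whose expectation
is `-λ ∇F(x)`, so its squared distance to a minimizer behaves as in SAGA except for an extra inner
product `2 λ² μ ⟨ȳ, ∇F(x)⟩`. The extrapolated point `x + λ ȳ` is sent to `x - λ t D`; by convexity and
the descent lemma, adding `2 λ μ (F(x + λ ȳ) - F⋆)` to the squared distance cancels the extra inner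
product up to the bias term `2 λ² μ t ⟨∇F(x), ȳ - ∇F(x)⟩` and a term of order `λ³ L μ t²`. With a
multiple of the squared error of the table as the third summand, the step size bound leaves a strict
decrease in expectation, proportional to the squared errors of the fresh and of the stored gradients
plus the suboptimality `F(x) - F⋆` (`exists_lyapunov_constants`, `sum_lyapunov_svagStep_le`).

By the supermartingale convergence theorem (`ae_summable_and_tendsto_of_average_le`), almost surely
these residuals are summable and the Lyapunov function converges, simultaneously for a dense sequence
of minimizers. Hence the distances to these minimizers converge, all cluster points are minimizers,
and Opial's lemma gives the limit (`exists_isMinOn_and_tendsto`). The rates hold because the minimum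
of finitely many terms is at most their average and the residuals are summable; that the residuals
refer to another minimizer than the limit does not matter, since the component gradients agree at
all minimizers (`gradient_eq_of_isMinOn`).
-/

/-! ### Smooth convex functions -/

section Smooth

variable {N : ℕ} {L : ℝ} {f : EuclideanSpace ℝ (Fin N) → ℝ}

lemma hasDerivAt_comp_line (hf : Differentiable ℝ f) (x h : EuclideanSpace ℝ (Fin N)) (τ : ℝ) :
    HasDerivAt (fun τ : ℝ => f (x + τ • h)) (inner ℝ (∇ f (x + τ • h)) h) τ := by
  have h1 : HasDerivAt (fun τ : ℝ => x + τ • h) h τ := by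
    simpa using ((hasDerivAt_id τ).smul_const h).const_add x
  have h2 := (hf (x + τ • h)).hasFDerivAt.comp_hasDerivAt τ h1
  rwa [← inner_gradient_left] at h2

lemma IsConvexSmooth.norm_gradient_sub_le (hf : IsConvexSmooth L f) (hL : 0 < L)
    (x y : EuclideanSpace ℝ (Fin N)) : ‖∇ f x - ∇ f y‖ ≤ L * ‖x - y‖ := by
  have h1 := hf.smooth x y
  have h2 := real_inner_le_norm (∇ f x - ∇ f y) (x - y)
  rcases (norm_nonneg (∇ f x - ∇ f y)).eq_or_lt with h0 | h0
  · rw [← h0]; positivity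
  · have h3 : 1 / L * ‖∇ f x - ∇ f y‖ ^ 2 ≤ ‖∇ f x - ∇ f y‖ * ‖x - y‖ := h1.trans h2
    have h4 : ‖∇ f x - ∇ f y‖ * ‖∇ f x - ∇ f y‖ ≤ ‖∇ f x - ∇ f y‖ * (L * ‖x - y‖) := by
      rw [one_div, inv_mul_le_iff₀ hL] at h3
      linarith
    exact le_of_mul_le_mul_left h4 h0

/-- The first-order characterization of convexity. -/
lemma IsConvexSmooth.add_inner_le (hf : IsConvexSmooth L f) (hL : 0 < L)
    (x h : EuclideanSpace ℝ (Fin N)) : f x + inner ℝ (∇ f x) h ≤ f (x + h) := by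
  obtain ⟨c, hc, hc'⟩ := exists_hasDerivAt_eq_slope (fun τ : ℝ => f (x + τ • h)) _ zero_lt_one
    (fun τ _ => (hasDerivAt_comp_line hf.differentiable x h τ).continuousAt.continuousWithinAt)
    (fun τ _ => hasDerivAt_comp_line hf.differentiable x h τ)
  have h1 := hf.smooth (x + c • h) x
  have h2 : 0 ≤ 1 / L * ‖∇ f (x + c • h) - ∇ f x‖ ^ 2 := by positivity
  simp only [add_sub_cancel_left, inner_smul_right, inner_sub_left] at h1
  have h3 := nonneg_of_mul_nonneg_right (h2.trans h1) hc.1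
  simp only [one_smul, zero_smul, add_zero, sub_zero, div_one] at hc'
  linarith

/-- The descent lemma. -/
lemma IsConvexSmooth.le_add_inner_add (hf : IsConvexSmooth L f) (hL : 0 < L)
    (x h : EuclideanSpace ℝ (Fin N)) :
    f (x + h) ≤ f x + inner ℝ (∇ f x) h + L / 2 * ‖h‖ ^ 2 := by
  -- The mean value theorem for `f (x + τ h)` minus the quadratic term gives the constant `L / 2`.
  have hd : ∀ τ : ℝ, HasDerivAt (fun τ : ℝ => f (x + τ • h) - L / 2 * ‖h‖ ^ 2 * τ ^ 2)
      (inner ℝ (∇ f (x + τ • h)) h - L / 2 * ‖h‖ ^ 2 * (2 * τ)) τ := fun τ => by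
    simpa using (hasDerivAt_comp_line hf.differentiable x h τ).fun_sub
      ((hasDerivAt_pow 2 τ).const_mul (L / 2 * ‖h‖ ^ 2))
  obtain ⟨c, hc, hc'⟩ := exists_hasDerivAt_eq_slope
    (fun τ : ℝ => f (x + τ • h) - L / 2 * ‖h‖ ^ 2 * τ ^ 2) _ zero_lt_one
    (fun τ _ => (hd τ).continuousAt.continuousWithinAt) (fun τ _ => hd τ)
  have h1 := hf.norm_gradient_sub_le hL (x + c • h) x
  have h2 := real_inner_le_norm (∇ f (x + c • h) - ∇ f x) h
  rw [add_sub_cancel_left, norm_smul, Real.norm_of_nonneg hc.1.le] at h1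
  have h3 := mul_le_mul_of_nonneg_right h1 (norm_nonneg h)
  rw [inner_sub_left] at h2
  simp only [one_smul, zero_smul, add_zero, sub_zero, div_one] at hc'
  nlinarith

end Smooth

section Objective

variable {N n : ℕ} {L : ℝ} {f : Fin n → EuclideanSpace ℝ (Fin N) → ℝ}

lemma objective_continuous (hf : ∀ i, IsConvexSmooth L (f i)) : Continuous (objective f) :=
  continuous_const.mul (continuous_finsetSum _ fun i _ => (hf i).differentiable.continuous)

lemma objective_add_inner_le (hL : 0 < L) (hf : ∀ i, IsConvexSmooth L (f i))
    (x h : EuclideanSpace ℝ (Fin N)) :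
    objective f x + (1 / (n : ℝ)) * ∑ i, inner ℝ (∇ (f i) x) h ≤ objective f (x + h) := by
  unfold objective
  rw [← mul_add, ← Finset.sum_add_distrib]
  gcongr with i
  exact (hf i).add_inner_le hL x h

lemma objective_le_add_inner_add (hn : 0 < n) (hL : 0 < L) (hf : ∀ i, IsConvexSmooth L (f i))
    (x h : EuclideanSpace ℝ (Fin N)) :
    objective f (x + h) ≤
      objective f x + (1 / (n : ℝ)) * ∑ i, inner ℝ (∇ (f i) x) h + L / 2 * ‖h‖ ^ 2 := by
  have hn' : (n : ℝ) ≠ 0 := by positivity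
  have h1 : L / 2 * ‖h‖ ^ 2 = (1 / (n : ℝ)) * ∑ _i : Fin n, L / 2 * ‖h‖ ^ 2 := by
    rw [Finset.sum_const, Finset.card_univ, Fintype.card_fin, nsmul_eq_mul]
    field_simp
  rw [h1]
  unfold objective
  rw [← mul_add, ← mul_add, ← Finset.sum_add_distrib, ← Finset.sum_add_distrib]
  gcongr with i
  exact (hf i).le_add_inner_add hL x h

lemma sum_gradient_eq_zero (hn : 0 < n) (hf : ∀ i, IsConvexSmooth L (f i))
    {xs : EuclideanSpace ℝ (Fin N)} (hxs : IsMinOn (objective f) Set.univ xs) :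
    ∑ i, ∇ (f i) xs = 0 := by
  have h1 : HasFDerivAt (objective f) ((1 / (n : ℝ)) • ∑ i, fderiv ℝ (f i) xs) xs := by
    have := (HasFDerivAt.fun_sum (u := Finset.univ)
      fun i _ => ((hf i).differentiable xs).hasFDerivAt).const_mul (1 / (n : ℝ))
    exact this
  have h2 := (hxs.isLocalMin Filter.univ_mem).hasFDerivAt_eq_zero h1
  have hn' : (1 / (n : ℝ)) ≠ 0 := by positivity
  have h3 := (smul_eq_zero.1 h2).resolve_left hn'
  refine ext_inner_right ℝ fun v => ?_
  simpa [sum_inner, inner_gradient_left] using congrArg (fun l => l v) h3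

/-- The component gradients agree at all minimizers of the objective. -/
lemma gradient_eq_of_isMinOn (hn : 0 < n) (hL : 0 < L) (hf : ∀ i, IsConvexSmooth L (f i))
    {xs xt : EuclideanSpace ℝ (Fin N)} (hxs : IsMinOn (objective f) Set.univ xs)
    (hxt : IsMinOn (objective f) Set.univ xt) (i : Fin n) : ∇ (f i) xs = ∇ (f i) xt := by
  have h1 : ∑ i, 1 / L * ‖∇ (f i) xs - ∇ (f i) xt‖ ^ 2 ≤
      ∑ i, inner ℝ (∇ (f i) xs - ∇ (f i) xt) (xs - xt) :=
    Finset.sum_le_sum fun i _ => (hf i).smooth xs xt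
  rw [← sum_inner, Finset.sum_sub_distrib, sum_gradient_eq_zero hn hf hxs,
    sum_gradient_eq_zero hn hf hxt, sub_zero, inner_zero_left] at h1
  have h2 := (Finset.sum_eq_zero_iff_of_nonneg fun i _ => by positivity).1
    (h1.antisymm (Finset.sum_nonneg fun i _ => by positivity)) i (Finset.mem_univ i)
  have h3 : ‖∇ (f i) xs - ∇ (f i) xt‖ ^ 2 = 0 :=
    (mul_eq_zero.1 h2).resolve_left (by positivity)
  exact sub_eq_zero.1 (norm_eq_zero.1 (pow_eq_zero_iff two_ne_zero |>.1 h3))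

end Objective

/-! ### Step sizes -/

lemma stepSizeBound_one (n : ℕ) (L : ℝ) : stepSizeBound n 1 L = 1 / (2 * L) := by
  simp [stepSizeBound, mul_comm]

lemma stepSizeBound_self (n : ℕ) (L : ℝ) : stepSizeBound n n L = 1 / (2 * L) := by
  simp [stepSizeBound, mul_comm]

/-- Bound for the part of the drift that the bias contributes; `a + b` is at most the amount for
which the step size bound leaves room. -/
lemma exists_cross_term_bound (t : ℝ) : ∃ a b : ℝ, 0 ≤ a ∧ 0 ≤ b ∧
    a + b ≤ 2 * t * (Real.sign t * √2 - 1) ∧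
    ∀ (E : Type) [NormedAddCommGroup E] [InnerProductSpace ℝ E] (g y : E),
      2 * t * inner ℝ g (y - g) ≤ a * ‖g‖ ^ 2 + b * ‖y‖ ^ 2 := by
  have hs : (1.25 : ℝ) ≤ √2 := Real.le_sqrt_of_sq_le (by norm_num)
  rcases lt_trichotomy t 0 with ht | rfl | ht
  · refine ⟨-3 * t, -t, by linarith, by linarith, ?_, fun E _ _ g y => ?_⟩
    · rw [Real.sign_of_neg ht]; nlinarith
    · have h := norm_add_sq_real g y
      rw [inner_sub_right, real_inner_self_eq_norm_sq]
      nlinarith [sq_nonneg ‖g + y‖]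
  · exact ⟨0, 0, le_rfl, le_rfl, by simp, fun E _ _ g y => by simp⟩
  · refine ⟨0, t / 2, le_rfl, by linarith, ?_, fun E _ _ g y => ?_⟩
    · rw [Real.sign_of_pos ht]; nlinarith
    · have h := norm_sub_sq_real g ((1 / 2 : ℝ) • y)
      rw [inner_smul_right, norm_smul, mul_pow] at h
      norm_num at h
      rw [inner_sub_right, real_inner_self_eq_norm_sq]
      nlinarith [sq_nonneg ‖g - (1 / 2 : ℝ) • y‖]

/-- Constants `γ` (weight of the table in the Lyapunov function) and `δ` (rate of its decrease)
that the step size bound allows. -/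
lemma exists_lyapunov_constants {n : ℕ} (hn : 0 < n) {L lam θ a b : ℝ} (hL : 0 < L)
    (hlam : 0 < lam) (hθ : θ ≤ n) (hstep : lam < stepSizeBound n θ L) (ha : 0 ≤ a) (hb : 0 ≤ b)
    (hab : a + b ≤ 2 * ((θ - 1) / n) * (Real.sign ((θ - 1) / n) * √2 - 1)) :
    ∃ γ δ : ℝ, 0 < γ ∧ 0 < δ ∧ δ ≤ 2 * lam ∧
      2 * lam ^ 2 + lam ^ 2 * (n - θ) * b + 2 * L * lam ^ 3 * (n - θ) * ((θ - 1) / n) ^ 2 + δ ≤ γ ∧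
      2 * lam ^ 2 + lam ^ 2 * (n - θ) * a + 2 * L * lam ^ 3 * (n - θ) * ((θ - 1) / n) ^ 2 + δ + γ
        + δ / L ≤ 2 * lam / L := by
  have hn' : (0 : ℝ) < n := by positivity
  have hsign : Real.sign (θ - 1) = Real.sign ((θ - 1) / n) := by
    rcases lt_trichotomy (θ - 1) 0 with h | h | h
    · rw [Real.sign_of_neg h, Real.sign_of_neg (div_neg_of_neg_of_pos h hn')]
    · simp [h]
    · rw [Real.sign_of_pos h, Real.sign_of_pos (by positivity)]
  unfold stepSizeBound at hstep
  rw [hsign] at hstep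
  set t := (θ - 1) / n
  set μ := (n : ℝ) - θ
  have hμ : 0 ≤ μ := sub_nonneg.2 hθ
  set s := Real.sign t * √2
  have hts : t ^ 2 ≤ t * (t - 1 + s) := by nlinarith
  set q := μ * t * (t - 1 + s)
  have hq0 : μ * (t ^ 2 + (a + b) / 2) ≤ q := by
    have : μ * (t ^ 2 + (a + b) / 2) ≤ μ * (t * (t - 1 + s)) :=
      mul_le_mul_of_nonneg_left (by nlinarith) hμ
    calc _ ≤ _ := this
      _ = q := by ring
  have hq1 : 0 ≤ q := le_trans (by positivity) hq0
  have h1 : lam * L * (2 + q) < 1 := by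
    rw [one_div_mul_one_div, lt_div_iff₀ (by positivity)] at hstep
    linarith
  have h2 : 2 * (lam * L) ≤ 1 := by nlinarith [mul_pos hlam hL, mul_nonneg (mul_pos hlam hL).le hq1]
  set K := 2 * L * lam ^ 3 * μ * t ^ 2
  have hK0 : 0 ≤ K := by positivity
  -- `S` is the room that the step size bound leaves.
  set S := 2 * lam / L - (4 * lam ^ 2 + lam ^ 2 * μ * (a + b) + 2 * K) with hSdef
  have hS : 0 < S := by
    have e1 : 2 * K ≤ 2 * lam ^ 2 * (μ * t ^ 2) := by
      have : 2 * K = (2 * (lam * L)) * (2 * lam ^ 2 * (μ * t ^ 2)) := by ring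
      rw [this]
      exact mul_le_of_le_one_left (by positivity) h2
    have e2 : 2 * lam * (lam * L * (2 + q)) < 2 * lam * 1 := by gcongr
    have e3 : 2 * lam ^ 2 * (2 + q) < 2 * lam / L := by
      rw [lt_div_iff₀ hL]; linarith
    have e4 := mul_le_mul_of_nonneg_left hq0 (by positivity : 0 ≤ 2 * lam ^ 2)
    rw [hSdef]
    linarith
  have hδ : 0 < S * L / (2 * (2 * L + 1)) := by positivity
  set δ := S * L / (2 * (2 * L + 1)) with hδdef
  have hδS : 2 * δ + δ / L ≤ S := by
    have : 2 * δ + δ / L = S / 2 := by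
      rw [hδdef]; field_simp
    linarith
  refine ⟨2 * lam ^ 2 + lam ^ 2 * μ * b + K + δ, δ, by positivity, hδ, ?_, le_rfl, ?_⟩
  · have hSL : S ≤ 2 * lam / L := by
      have : 0 ≤ 4 * lam ^ 2 + lam ^ 2 * μ * (a + b) + 2 * K := by positivity
      linarith
    have : δ / L ≤ 2 * lam / L := by linarith
    exact (div_le_div_iff_of_pos_right hL).1 this
  · linarith

/-! ### The Lyapunov function -/

section Averages

variable {E : Type*} [NormedAddCommGroup E] [InnerProductSpace ℝ E] {n : ℕ}

/-- The bias-variance decomposition. -/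
lemma sum_norm_sub_mean_sq (u : Fin n → E) {m : E} (hm : ∑ i, u i = (n : ℝ) • m) :
    ∑ i, ‖u i - m‖ ^ 2 = ∑ i, ‖u i‖ ^ 2 - n * ‖m‖ ^ 2 := by
  simp_rw [norm_sub_sq_real]
  rw [Finset.sum_add_distrib, Finset.sum_sub_distrib, ← Finset.mul_sum, ← sum_inner, hm,
    inner_smul_left, real_inner_self_eq_norm_sq]
  simp
  ring

lemma norm_sub_sq_le_two_mul (u v : E) : ‖u - v‖ ^ 2 ≤ 2 * ‖u‖ ^ 2 + 2 * ‖v‖ ^ 2 := by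
  have := parallelogram_law_with_norm ℝ u v
  nlinarith [sq_nonneg ‖u + v‖]

lemma mul_norm_mean_sq_le (u : Fin n → E) {m : E} (hm : ∑ i, u i = (n : ℝ) • m) :
    n * ‖m‖ ^ 2 ≤ ∑ i, ‖u i‖ ^ 2 := by
  have h1 := sum_norm_sub_mean_sq u hm
  have h2 : 0 ≤ ∑ i, ‖u i - m‖ ^ 2 := by positivity
  linarith

end Averages

section Lyapunov

variable {N n : ℕ}

/-- The Lyapunov function of SVAG relative to a minimizer `xs`. With `ȳ` the mean of the stored
gradients, it consists of the squared distance from `xs` of the shifted iterate `x - λ (n - θ) ȳ`,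
whose expected step is `-λ ∇F(x)`, of the suboptimality at the extrapolated point `x + λ ȳ`, which
for `θ = 1` is the previous iterate, and of the error of the table. -/
noncomputable def lyapunov (f : Fin n → EuclideanSpace ℝ (Fin N) → ℝ) (lam θ γ : ℝ)
    (xs : EuclideanSpace ℝ (Fin N))
    (z : EuclideanSpace ℝ (Fin N) × (Fin n → EuclideanSpace ℝ (Fin N))) : ℝ :=
  ‖z.1 - (lam * (n - θ)) • ((1 / (n : ℝ)) • ∑ j, z.2 j) - xs‖ ^ 2
    + 2 * lam * (n - θ) * (objective f (z.1 + lam • ((1 / (n : ℝ)) • ∑ j, z.2 j)) - objective f xs)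
    + γ * ∑ j, ‖z.2 j - ∇ (f j) xs‖ ^ 2

/-- The quantity that bounds from below, up to a constant factor, the expected decrease of the
Lyapunov function in one iteration. -/
noncomputable def optimalityGap (f : Fin n → EuclideanSpace ℝ (Fin N) → ℝ)
    (xs : EuclideanSpace ℝ (Fin N))
    (z : EuclideanSpace ℝ (Fin N) × (Fin n → EuclideanSpace ℝ (Fin N))) : ℝ :=
  (1 / (n : ℝ)) * (∑ j, ‖∇ (f j) z.1 - ∇ (f j) xs‖ ^ 2 + ∑ j, ‖z.2 j - ∇ (f j) xs‖ ^ 2)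
    + (objective f z.1 - objective f xs)

variable {f : Fin n → EuclideanSpace ℝ (Fin N) → ℝ} {lam θ γ δ L : ℝ}
  {xs : EuclideanSpace ℝ (Fin N)}

lemma optimalityGap_nonneg (hxs : IsMinOn (objective f) Set.univ xs)
    (z : EuclideanSpace ℝ (Fin N) × (Fin n → EuclideanSpace ℝ (Fin N))) :
    0 ≤ optimalityGap f xs z := by
  have : 0 ≤ objective f z.1 - objective f xs := sub_nonneg.2 (hxs (Set.mem_univ _))
  unfold optimalityGap
  positivity

lemma lyapunov_nonneg (hlam : 0 < lam) (hθ : θ ≤ n) (hγ : 0 < γ)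
    (hxs : IsMinOn (objective f) Set.univ xs)
    (z : EuclideanSpace ℝ (Fin N) × (Fin n → EuclideanSpace ℝ (Fin N))) :
    0 ≤ lyapunov f lam θ γ xs z := by
  have h1 : 0 ≤ objective f (z.1 + lam • ((1 / (n : ℝ)) • ∑ j, z.2 j)) - objective f xs :=
    sub_nonneg.2 (hxs (Set.mem_univ _))
  have h2 : 0 ≤ (n : ℝ) - θ := sub_nonneg.2 hθ
  unfold lyapunov
  positivity

/-- Replacing one table entry changes the squared error of the table in one summand. -/
lemma sum_update_norm_sub_sq {E : Type*} [NormedAddCommGroup E] (y ys : Fin n → E) (i : Fin n)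
    (g : E) : ∑ j, ‖Function.update y i g j - ys j‖ ^ 2
      = ∑ j, ‖y j - ys j‖ ^ 2 + ‖g - ys i‖ ^ 2 - ‖y i - ys i‖ ^ 2 := by
  rw [← Finset.add_sum_erase _ _ (Finset.mem_univ i),
    ← Finset.add_sum_erase _ (fun j => ‖y j - ys j‖ ^ 2) (Finset.mem_univ i)]
  rw [Finset.sum_congr rfl fun j hj => by rw [Function.update_of_ne (Finset.ne_of_mem_erase hj)]]
  simp only [Function.update_self]
  ring

lemma sum_update {E : Type*} [AddCommGroup E] (y : Fin n → E) (i : Fin n) (g : E) :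
    ∑ j, Function.update y i g j = ∑ j, y j + (g - y i) := by
  rw [← Finset.add_sum_erase _ _ (Finset.mem_univ i), ← Finset.add_sum_erase _ y (Finset.mem_univ i)]
  rw [Finset.sum_congr rfl fun j hj => by rw [Function.update_of_ne (Finset.ne_of_mem_erase hj)]]
  simp only [Function.update_self]
  abel

/-- The expected decrease of the Lyapunov function in one iteration. -/
lemma sum_lyapunov_svagStep_le (hn : 0 < n) (hL : 0 < L) (hf : ∀ i, IsConvexSmooth L (f i))
    (hlam : 0 < lam) (hθ : θ ≤ n) (hxs : IsMinOn (objective f) Set.univ xs) {a b : ℝ}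
    (ha : 0 ≤ a) (hb : 0 ≤ b)
    (hcross : ∀ g y : EuclideanSpace ℝ (Fin N),
      2 * ((θ - 1) / n) * inner ℝ g (y - g) ≤ a * ‖g‖ ^ 2 + b * ‖y‖ ^ 2)
    (hδ : 0 ≤ δ) (hδ2 : δ ≤ 2 * lam)
    (hB : 2 * lam ^ 2 + lam ^ 2 * (n - θ) * b
      + 2 * L * lam ^ 3 * (n - θ) * ((θ - 1) / n) ^ 2 + δ ≤ γ)
    (hA : 2 * lam ^ 2 + lam ^ 2 * (n - θ) * a
      + 2 * L * lam ^ 3 * (n - θ) * ((θ - 1) / n) ^ 2 + δ + γ + δ / L ≤ 2 * lam / L)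
    (z : EuclideanSpace ℝ (Fin N) × (Fin n → EuclideanSpace ℝ (Fin N))) :
    (1 / (n : ℝ)) * ∑ i, lyapunov f lam θ γ xs (svagStep f lam θ i z)
      ≤ lyapunov f lam θ γ xs z - δ * optimalityGap f xs z := by
  obtain ⟨x, y⟩ := z
  have hn' : (0 : ℝ) < n := by positivity
  have hcard : ∀ c : ℝ, ∑ _i : Fin n, c = n * c := fun c => by simp
  set t := (θ - 1) / n with ht
  set μ := (n : ℝ) - θ with hμdef
  have hμ : 0 ≤ μ := sub_nonneg.2 hθ
  set yb : EuclideanSpace ℝ (Fin N) := (1 / (n : ℝ)) • ∑ j, y j with hyb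
  set gb : EuclideanSpace ℝ (Fin N) := (1 / (n : ℝ)) • ∑ j, ∇ (f j) x with hgb
  set v := x - (lam * μ) • yb - xs with hv
  set A := ∑ j, ‖∇ (f j) x - ∇ (f j) xs‖ ^ 2 with hAdef
  set B := ∑ j, ‖y j - ∇ (f j) xs‖ ^ 2 with hBdef
  have hstar := sum_gradient_eq_zero hn hf hxs
  have hsumy : ∑ j, y j = (n : ℝ) • yb := by
    rw [hyb, smul_smul, mul_one_div_cancel hn'.ne', one_smul]
  have hsumg : ∑ j, ∇ (f j) x = (n : ℝ) • gb := by
    rw [hgb, smul_smul, mul_one_div_cancel hn'.ne', one_smul]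
  have hsumY : ∑ j, (y j - ∇ (f j) xs) = (n : ℝ) • yb := by
    rw [Finset.sum_sub_distrib, hstar, sub_zero, hsumy]
  have hsumG : ∑ j, (∇ (f j) x - ∇ (f j) xs) = (n : ℝ) • gb := by
    rw [Finset.sum_sub_distrib, hstar, sub_zero, hsumg]
  have hsumD : ∑ j, (∇ (f j) x - y j) = (n : ℝ) • (gb - yb) := by
    rw [Finset.sum_sub_distrib, hsumg, hsumy, smul_sub]
  have hA0 : n * ‖gb‖ ^ 2 ≤ A := mul_norm_mean_sq_le _ hsumG
  have hB0 : n * ‖yb‖ ^ 2 ≤ B := mul_norm_mean_sq_le _ hsumY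
  -- The shifted and the extrapolated point move along `yb + D` and `D`, where `D` is the innovation.
  have hshift : ∀ i, (svagStep f lam θ i (x, y)).1
      - (lam * μ) • ((1 / (n : ℝ)) • ∑ j, (svagStep f lam θ i (x, y)).2 j) - xs
      = v - lam • (yb + (∇ (f i) x - y i)) := fun i => by
    simp only [svagStep, sum_update, ← hyb, smul_add, hv]
    rw [hμdef]
    match_scalars <;> field_simp <;> ring
  have hextra : ∀ i, (svagStep f lam θ i (x, y)).1
      + lam • ((1 / (n : ℝ)) • ∑ j, (svagStep f lam θ i (x, y)).2 j)
      = x + (-(lam * t)) • (∇ (f i) x - y i) := fun i => by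
    simp only [svagStep, sum_update, ← hyb, smul_add]
    rw [ht]
    match_scalars <;> field_simp <;> ring
  have hobj : ∀ h, (1 / (n : ℝ)) * ∑ i, inner ℝ (∇ (f i) x) h = inner ℝ gb h := fun h => by
    rw [hgb, inner_smul_left, sum_inner]; simp
  have hD : ∑ i, ‖∇ (f i) x - y i‖ ^ 2 ≤ 2 * A + 2 * B := by
    rw [hAdef, hBdef, Finset.mul_sum, Finset.mul_sum, ← Finset.sum_add_distrib]
    refine Finset.sum_le_sum fun i _ => ?_
    rw [← sub_sub_sub_cancel_right _ _ (∇ (f i) xs)]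
    exact norm_sub_sq_le_two_mul _ _
  have hDy : ∑ i, ‖yb + (∇ (f i) x - y i)‖ ^ 2 ≤ 2 * A + 2 * B := by
    have h1 : ∑ i, ‖yb + (∇ (f i) x - y i)‖ ^ 2
        ≤ 2 * A + 2 * ∑ i, ‖(y i - ∇ (f i) xs) - yb‖ ^ 2 := by
      rw [hAdef, Finset.mul_sum, Finset.mul_sum, ← Finset.sum_add_distrib]
      refine Finset.sum_le_sum fun i _ => ?_
      have : yb + (∇ (f i) x - y i)
          = (∇ (f i) x - ∇ (f i) xs) - ((y i - ∇ (f i) xs) - yb) := by abel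
      rw [this]
      exact norm_sub_sq_le_two_mul _ _
    rw [sum_norm_sub_mean_sq _ hsumY] at h1
    nlinarith [sq_nonneg ‖yb‖]
  -- The distance term.
  have hdist : ∑ i, ‖v - lam • (yb + (∇ (f i) x - y i))‖ ^ 2
      ≤ n * ‖v‖ ^ 2 - 2 * lam * (n * inner ℝ v gb) + lam ^ 2 * (2 * A + 2 * B) := by
    simp_rw [norm_sub_sq_real, norm_smul, mul_pow, inner_smul_right]
    rw [Finset.sum_add_distrib, Finset.sum_sub_distrib, hcard, ← Finset.mul_sum, ← Finset.mul_sum,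
      ← Finset.mul_sum, ← inner_sum, Finset.sum_add_distrib, hsumD, Finset.sum_const,
      Finset.card_univ, Fintype.card_fin, ← Nat.cast_smul_eq_nsmul ℝ, ← smul_add,
      add_sub_cancel, inner_smul_right, Real.norm_of_nonneg hlam.le]
    have := mul_le_mul_of_nonneg_left hDy (sq_nonneg lam)
    linarith
  have hvgb : inner ℝ v gb = inner ℝ gb (x - xs) - lam * μ * inner ℝ gb yb := by
    rw [hv, real_inner_comm, sub_right_comm, inner_sub_right, inner_smul_right]
  have hcoco : A / L ≤ n * inner ℝ gb (x - xs) := by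
    have h1 : ∑ i, 1 / L * ‖∇ (f i) x - ∇ (f i) xs‖ ^ 2 ≤
        ∑ i, inner ℝ (∇ (f i) x - ∇ (f i) xs) (x - xs) :=
      Finset.sum_le_sum fun i _ => (hf i).smooth x xs
    rw [← sum_inner, hsumG, inner_smul_left, ← Finset.mul_sum, ← hAdef] at h1
    simpa [div_eq_inv_mul] using h1
  have hconv : objective f x - objective f xs ≤ inner ℝ gb (x - xs) := by
    have h1 := objective_add_inner_le hL hf x (xs - x)
    rw [hobj, add_sub_cancel, ← neg_sub x xs, inner_neg_right] at h1
    linarith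
  -- The objective term.
  have hF : ∑ i, objective f (x + (-(lam * t)) • (∇ (f i) x - y i))
      ≤ n * objective f x + lam * t * (n * inner ℝ gb (yb - gb))
        + L / 2 * (lam * t) ^ 2 * (2 * A + 2 * B) := by
    calc ∑ i, objective f (x + (-(lam * t)) • (∇ (f i) x - y i))
        ≤ ∑ i, (objective f x + -(lam * t) * inner ℝ gb (∇ (f i) x - y i)
            + L / 2 * (lam * t) ^ 2 * ‖∇ (f i) x - y i‖ ^ 2) := by
          refine Finset.sum_le_sum fun i _ => ?_
          have h1 := objective_le_add_inner_add hn hL hf x ((-(lam * t)) • (∇ (f i) x - y i))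
          rw [hobj, inner_smul_right, norm_smul, mul_pow, Real.norm_eq_abs, sq_abs, neg_sq] at h1
          linarith
      _ = n * objective f x + -(lam * t) * (n * inner ℝ gb (gb - yb))
            + L / 2 * (lam * t) ^ 2 * ∑ i, ‖∇ (f i) x - y i‖ ^ 2 := by
          rw [Finset.sum_add_distrib, Finset.sum_add_distrib, hcard, ← Finset.mul_sum,
            ← Finset.mul_sum, ← inner_sum, hsumD, inner_smul_right]
      _ ≤ _ := by
          rw [← neg_sub yb gb, inner_neg_right]
          have := mul_le_mul_of_nonneg_left hD (by positivity : 0 ≤ L / 2 * (lam * t) ^ 2)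
          linarith
  have hFy : objective f x + lam * inner ℝ gb yb ≤ objective f (x + lam • yb) := by
    have h1 := objective_add_inner_le hL hf x (lam • yb)
    rwa [hobj, inner_smul_right] at h1
  -- The table term.
  have htab : ∑ i, ∑ j, ‖(svagStep f lam θ i (x, y)).2 j - ∇ (f j) xs‖ ^ 2
      = n * B + A - B := by
    simp only [svagStep]
    rw [Finset.sum_congr rfl fun i _ =>
      sum_update_norm_sub_sq y (fun j => ∇ (f j) xs) i (∇ (f i) x)]
    rw [Finset.sum_sub_distrib, Finset.sum_add_distrib, hcard]
  have hc := hcross gb yb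
  have hsum : ∑ i, lyapunov f lam θ γ xs (svagStep f lam θ i (x, y))
      = ∑ i, ‖v - lam • (yb + (∇ (f i) x - y i))‖ ^ 2
        + 2 * lam * μ * (∑ i, objective f (x + (-(lam * t)) • (∇ (f i) x - y i))
            - n * objective f xs)
        + γ * (n * B + A - B) := by
    unfold lyapunov
    simp_rw [← hμdef, hshift, hextra]
    rw [Finset.sum_add_distrib, Finset.sum_add_distrib, ← Finset.mul_sum, ← Finset.mul_sum,
      Finset.sum_sub_distrib, hcard, htab]
  have hrhs : lyapunov f lam θ γ xs (x, y) - δ * optimalityGap f xs (x, y)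
      = ‖v‖ ^ 2 + 2 * lam * μ * (objective f (x + lam • yb) - objective f xs) + γ * B
        - δ * (1 / n * (A + B) + (objective f x - objective f xs)) := rfl
  rw [hrhs, one_div, inv_mul_le_iff₀ hn', hsum]
  set F := objective f x
  set Fs := objective f xs
  set Fy := objective f (x + lam • yb)
  set SF := ∑ i, objective f (x + (-(lam * t)) • (∇ (f i) x - y i))
  set p := inner ℝ gb yb
  set r := inner ℝ gb (x - xs)
  have e1 := mul_le_mul_of_nonneg_left hF (by positivity : 0 ≤ 2 * lam * μ)
  have e2 := mul_le_mul_of_nonneg_left hFy (by positivity : 0 ≤ 2 * lam * μ * n)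
  have e3 := mul_le_mul_of_nonneg_left hc (by positivity : 0 ≤ lam ^ 2 * μ * n)
  have e4 := mul_le_mul_of_nonneg_left hA0 (by positivity : 0 ≤ lam ^ 2 * μ * a)
  have e5 := mul_le_mul_of_nonneg_left hB0 (by positivity : 0 ≤ lam ^ 2 * μ * b)
  have e6 := mul_le_mul_of_nonneg_left hcoco (by linarith : 0 ≤ 2 * lam - δ)
  have hA1 : 0 ≤ A := by positivity
  have hB1 : 0 ≤ B := by positivity
  have e7 := mul_le_mul_of_nonneg_left hconv (by positivity : 0 ≤ δ * n)
  have e8 := mul_le_mul_of_nonneg_left hA hA1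
  have e9 := mul_le_mul_of_nonneg_left hB hB1
  rw [hvgb] at hdist
  have e10 : (n : ℝ) * (δ * ((n : ℝ)⁻¹ * (A + B) + (F - Fs)))
      = δ * (A + B) + δ * n * (F - Fs) := by
    field_simp
  rw [mul_sub _ _ (δ * _), e10]
  linear_combination hdist + e1 + e2 + e3 + e4 + e5 + e6 + e7 + e8 + e9

end Lyapunov

/-! ### Supermartingales along randomly driven recursions -/

section Driven

variable {n : ℕ} {Ω : Type*} {s : ℕ → Ω → Fin n}

/-- The tuple of the indices sampled in the iterations before `k`. -/
def sampledPrefix (s : ℕ → Ω → Fin n) (k : ℕ) (ω : Ω) : Finset.range k → Fin n :=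
  fun j => s j ω

/-- A state that is updated by the sampled indices is a function of the indices sampled so far. -/
lemma exists_eq_comp_sampledPrefix {α : Type*} (step : Fin n → α → α) (z0 : α) (z : ℕ → Ω → α)
    (hz0 : ∀ ω, z 0 ω = z0) (hz : ∀ k ω, z (k + 1) ω = step (s k ω) (z k ω)) (k : ℕ) :
    ∃ φ : (Finset.range k → Fin n) → α, ∀ ω, z k ω = φ (sampledPrefix s k ω) := by
  induction k with
  | zero => exact ⟨fun _ => z0, hz0⟩
  | succ k ih =>
    obtain ⟨φ, hφ⟩ := ih
    refine ⟨fun τ => step (τ ⟨k, Finset.self_mem_range_succ k⟩)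
      (φ fun j => τ ⟨j, Finset.range_mono k.le_succ j.2⟩), fun ω => ?_⟩
    rw [hz, hφ]
    rfl

variable [mΩ : MeasurableSpace Ω] {P : Measure Ω}

lemma measurable_sampledPrefix (hs : ∀ k, Measurable (s k)) (k : ℕ) :
    Measurable (sampledPrefix s k) := measurable_pi_lambda _ fun j => hs j

/-- The filtration of the indices sampled in the past (the current one excluded). -/
def sampledFiltration (hs : ∀ k, Measurable (s k)) : Filtration ℕ mΩ where
  seq k := MeasurableSpace.comap (sampledPrefix s k) inferInstance
  mono' i k hik := by
    have h : sampledPrefix s i = (fun τ (j : Finset.range i) =>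
        τ ⟨j, Finset.range_mono hik j.2⟩) ∘ sampledPrefix s k := rfl
    change MeasurableSpace.comap (sampledPrefix s i) _ ≤ _
    rw [h, ← MeasurableSpace.comap_comp]
    exact MeasurableSpace.comap_mono (measurable_pi_lambda _ fun j => measurable_pi_apply _).comap_le
  le' k := (measurable_sampledPrefix hs k).comap_le

lemma integrable_comp_sampledPrefix [IsFiniteMeasure P] (hs : ∀ k, Measurable (s k)) (k : ℕ)
    (φ : (Finset.range k → Fin n) → ℝ) : Integrable (fun ω => φ (sampledPrefix s k ω)) P := by
  obtain ⟨C, hC⟩ := (Set.finite_range fun τ => ‖φ τ‖).bddAbove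
  exact Integrable.of_bound
    ((measurable_of_finite φ).comp (measurable_sampledPrefix hs k)).aestronglyMeasurable C
    (ae_of_all _ fun ω => hC ⟨_, rfl⟩)

lemma measureReal_sample_eq (hs : IsUniformSampling P s) (k : ℕ) (j : Fin n) :
    P.real {ω | s k ω = j} = 1 / (n : ℝ) := by
  simp [Measure.real, hs.uniform k j]

/-- The current index is independent of the past, so integrating it out averages over `Fin n`. -/
lemma integral_sampledPrefix_sample [IsProbabilityMeasure P] (hs : IsUniformSampling P s) (k : ℕ)
    (ψ : Fin n → (Finset.range k → Fin n) → ℝ) :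
    ∫ ω, ψ (s k ω) (sampledPrefix s k ω) ∂P
      = ∫ ω, (1 / (n : ℝ)) * ∑ j, ψ j (sampledPrefix s k ω) ∂P := by
  have hind : IndepFun (s k) (sampledPrefix s k) P := by
    have h := hs.indep.indepFun_finset {k} (Finset.range k) (by simp) hs.measurable
    exact h.comp (φ := fun τ : ({k} : Finset ℕ) → Fin n => τ ⟨k, Finset.mem_singleton_self k⟩)
      (measurable_of_finite _) measurable_id
  have hset : ∀ j, MeasurableSet {ω | s k ω = j} := fun j =>
    hs.measurable k (measurableSet_singleton j)
  have hsplit : ∀ ω, ψ (s k ω) (sampledPrefix s k ω)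
      = ∑ j, (if s k ω = j then (1 : ℝ) else 0) * ψ j (sampledPrefix s k ω) := fun ω => by simp
  have hterm : ∀ j, ∫ ω, (if s k ω = j then (1 : ℝ) else 0) * ψ j (sampledPrefix s k ω) ∂P
      = 1 / (n : ℝ) * ∫ ω, ψ j (sampledPrefix s k ω) ∂P := fun j => by
    have h := (hind.comp (φ := fun i => if i = j then (1 : ℝ) else 0) (ψ := ψ j)
      (measurable_of_finite _) (measurable_of_finite _)).integral_mul_eq_mul_integral
      ((measurable_of_finite _).comp (hs.measurable k)).aestronglyMeasurable
      ((measurable_of_finite _).comp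
        (measurable_sampledPrefix hs.measurable k)).aestronglyMeasurable
    have h' : ∫ ω, (if s k ω = j then (1 : ℝ) else 0) ∂P = 1 / (n : ℝ) := by
      rw [← measureReal_sample_eq hs k j, ← integral_indicator_one (hset j)]
      simp only [Set.indicator_apply, Set.mem_ofPred_eq, Pi.one_apply]
    rw [← h']
    exact h
  simp_rw [hsplit]
  rw [integral_finsetSum, integral_const_mul, integral_finsetSum, Finset.mul_sum]
  · exact Finset.sum_congr rfl fun j _ => hterm j
  · exact fun j _ => integrable_comp_sampledPrefix hs.measurable k (ψ j)
  · intro j _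
    refine (integrable_comp_sampledPrefix hs.measurable k (ψ j)).bdd_mul (c := 1)
      ((measurable_of_finite fun i => if i = j then (1 : ℝ) else 0).comp
        (hs.measurable k)).aestronglyMeasurable (ae_of_all _ fun ω => ?_)
    change ‖(if s k ω = j then (1 : ℝ) else 0)‖ ≤ 1
    split_ifs <;> simp

/-- The Robbins–Siegmund argument for a state that is updated by the sampled indices: if the average
of `V` over the possible updates is at most `V - W`, then `V` converges and `W` is summable along
almost every trajectory. -/
lemma ae_summable_and_tendsto_of_average_le [IsProbabilityMeasure P] (hs : IsUniformSampling P s)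
    {α : Type*} (step : Fin n → α → α) (z0 : α) (z : ℕ → Ω → α)
    (hz0 : ∀ ω, z 0 ω = z0) (hz : ∀ k ω, z (k + 1) ω = step (s k ω) (z k ω))
    (V W : α → ℝ) (hV : ∀ u, 0 ≤ V u) (hW : ∀ u, 0 ≤ W u)
    (hVW : ∀ u, (1 / (n : ℝ)) * ∑ i, V (step i u) ≤ V u - W u) :
    ∀ᵐ ω ∂P, Summable (fun k => W (z k ω)) ∧ ∃ l, Tendsto (fun k => V (z k ω)) atTop (𝓝 l) := by
  have hn : (n : ℝ) ≠ 0 := by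
    obtain ⟨ω⟩ := nonempty_of_isProbabilityMeasure P
    have := (s 0 ω).pos
    positivity
  -- `V` plus the accumulated decrease is a nonnegative supermartingale.
  set M : ℕ → Ω → ℝ := fun k ω => V (z k ω) + ∑ t ∈ Finset.range k, W (z t ω) with hM
  have hM0 : ∀ k ω, 0 ≤ M k ω := fun k ω => add_nonneg (hV _) (Finset.sum_nonneg fun _ _ => hW _)
  have hrep : ∀ k, ∃ φ : (Finset.range k → Fin n) → α × ℝ,
      ∀ ω, (z k ω, ∑ t ∈ Finset.range k, W (z t ω)) = φ (sampledPrefix s k ω) := fun k =>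
    exists_eq_comp_sampledPrefix (fun i u => (step i u.1, u.2 + W u.1)) (z0, 0)
      (fun k ω => (z k ω, ∑ t ∈ Finset.range k, W (z t ω))) (by simp [hz0])
      (fun k ω => by simp [hz, Finset.sum_range_succ]) k
  have hMrep : ∀ k, ∃ φ : (Finset.range k → Fin n) → ℝ,
      ∀ ω, M k ω = φ (sampledPrefix s k ω) := fun k => by
    obtain ⟨φ, hφ⟩ := hrep k
    exact ⟨fun τ => V (φ τ).1 + (φ τ).2, fun ω => by simp only [← hφ, hM]⟩
  have hint : ∀ k, Integrable (M k) P := fun k => by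
    obtain ⟨φ, hφ⟩ := hMrep k
    rw [funext hφ]
    exact integrable_comp_sampledPrefix hs.measurable k φ
  have hsuper : Supermartingale M (sampledFiltration hs.measurable) P := by
    refine supermartingale_of_setIntegral_succ_le (fun k => ?_) hint fun k A hA => ?_
    · obtain ⟨φ, hφ⟩ := hMrep k
      rw [funext hφ]
      exact ((measurable_of_finite φ).comp (comap_measurable _)).stronglyMeasurable
    · obtain ⟨B, -, rfl⟩ := hA
      obtain ⟨φ, hφ⟩ := hrep k
      have hBm : MeasurableSet (sampledPrefix s k ⁻¹' B) :=
        measurable_sampledPrefix hs.measurable k (Set.toFinite B).measurableSet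
      rw [← integral_indicator hBm, ← integral_indicator hBm]
      have h1 : ∀ ω, (sampledPrefix s k ⁻¹' B).indicator (M (k + 1)) ω
          = (fun i τ => B.indicator
              (fun τ => V (step i (φ τ).1) + ((φ τ).2 + W (φ τ).1)) τ)
            (s k ω) (sampledPrefix s k ω) := fun ω => by
        simp only [Set.indicator, Set.mem_preimage, ← hφ, hM, hz, Finset.sum_range_succ]
        rfl
      have h2 : ∀ ω, (sampledPrefix s k ⁻¹' B).indicator (M k) ω
          = B.indicator (fun τ => V (φ τ).1 + (φ τ).2) (sampledPrefix s k ω) := fun ω => by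
        simp only [Set.indicator, Set.mem_preimage, ← hφ, hM]
        rfl
      simp_rw [h1, h2]
      rw [integral_sampledPrefix_sample hs k (fun i τ => B.indicator
              (fun τ => V (step i (φ τ).1) + ((φ τ).2 + W (φ τ).1)) τ)]
      refine integral_mono
        (integrable_comp_sampledPrefix hs.measurable k fun τ => 1 / (n : ℝ) * ∑ j,
          B.indicator (fun τ => V (step j (φ τ).1) + ((φ τ).2 + W (φ τ).1)) τ)
        (integrable_comp_sampledPrefix hs.measurable k _) fun ω => ?_
      by_cases hω : sampledPrefix s k ω ∈ B
      · simp only [Set.indicator_of_mem hω, Finset.sum_add_distrib, mul_add, Finset.sum_const,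
          Finset.card_univ, Fintype.card_fin, nsmul_eq_mul, one_div, inv_mul_cancel_left₀ hn]
        have := hVW (φ (sampledPrefix s k ω)).1
        rw [one_div] at this
        linarith
      · simp [Set.indicator_of_notMem hω]
  have hbdd : ∀ k, eLpNorm ((-M) k) 1 P ≤ (Real.toNNReal (∫ ω, M 0 ω ∂P) : ℝ≥0∞) := fun k => by
    rw [Pi.neg_apply, eLpNorm_neg, eLpNorm_one_eq_lintegral_enorm,
      ← ofReal_integral_norm_eq_lintegral_enorm (hint k)]
    refine ENNReal.ofReal_le_ofReal ?_
    simp_rw [Real.norm_of_nonneg (hM0 k _)]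
    simpa using hsuper.setIntegral_le (Nat.zero_le k) MeasurableSet.univ
  filter_upwards [hsuper.neg.exists_ae_tendsto_of_bdd hbdd] with ω ⟨c, hc⟩
  have hc' : Tendsto (fun k => M k ω) atTop (𝓝 (-c)) := by simpa using hc.neg
  obtain ⟨C, hC⟩ := hc'.bddAbove_range
  have hsum : Summable fun k => W (z k ω) := by
    refine summable_of_sum_range_le (c := C) (fun _ => hW _) fun k => ?_
    have : M k ω ≤ C := hC ⟨k, rfl⟩
    have h0 := hV (z k ω)
    simp only [hM] at this
    linarith
  refine ⟨hsum, _, (hc'.sub hsum.hasSum.tendsto_sum_nat).congr fun k => ?_⟩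
  simp [hM]

end Driven

/-! ### Convergence of trajectories -/

/-- Opial's lemma, with the convergence of distances required for a dense sequence only. -/
lemma exists_tendsto_of_tendsto_norm_sub {E : Type*} [NormedAddCommGroup E] [ProperSpace E]
    {S : Set E} (x : ℕ → E) (d : ℕ → S) (hd : DenseRange d)
    (hdist : ∀ j, ∃ l, Tendsto (fun k => ‖x k - d j‖) atTop (𝓝 l))
    (hclus : ∀ p, ∀ φ : ℕ → ℕ, StrictMono φ → Tendsto (x ∘ φ) atTop (𝓝 p) → p ∈ S) :
    ∃ p ∈ S, Tendsto x atTop (𝓝 p) := by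
  obtain ⟨l, hl⟩ := hdist 0
  obtain ⟨C, hC⟩ := hl.bddAbove_range
  obtain ⟨p, -, φ, hφ, hp⟩ := tendsto_subseq_of_bounded (Metric.isBounded_closedBall (x := (d 0 : E))
    (r := C)) (fun k => by rw [mem_closedBall_iff_norm]; exact hC ⟨k, rfl⟩ : ∀ k, x k ∈ _)
  have hpS := hclus p φ hφ hp
  refine ⟨p, hpS, Metric.tendsto_atTop'.2 fun ε hε => ?_⟩
  obtain ⟨j, hj⟩ := hd.exists_dist_lt ⟨p, hpS⟩ (half_pos hε)
  have hj' : ‖p - d j‖ < ε / 2 := by rw [← dist_eq_norm]; exact hj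
  obtain ⟨m, hm⟩ := hdist j
  have hlim : m = ‖p - d j‖ :=
    tendsto_nhds_unique (hm.comp hφ.tendsto_atTop) ((hp.sub_const _).norm)
  rw [hlim] at hm
  obtain ⟨K, hK⟩ := eventually_atTop.1 (hm.eventually_lt_const hj')
  refine ⟨K, fun k hk => ?_⟩
  rw [dist_eq_norm, ← sub_sub_sub_cancel_right _ _ (d j : E)]
  have := hK k hk.le
  have := norm_sub_le (x k - d j) (p - d j)
  linarith

/-- The running minimum of a sequence is at most its average. -/
lemma runningMin_sub_isBigO {a : ℕ → ℝ} {c : ℝ} (hc : ∀ k, c ≤ a k)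
    (ha : Summable fun k => a k - c) :
    (fun k => runningMin a k - c) =O[atTop] fun k : ℕ => 1 / (k : ℝ) := by
  refine IsBigO.of_bound (∑' k, (a k - c)) ?_
  filter_upwards [eventually_gt_atTop 0] with k hk
  have hk' : (0 : ℝ) < k := by positivity
  have h0 : c ≤ runningMin a k := Finset.le_inf' _ _ fun t _ => hc t
  have h1 : ∑ _t ∈ Finset.range (k + 1), (runningMin a k - c)
      ≤ ∑ t ∈ Finset.range (k + 1), (a t - c) :=
    Finset.sum_le_sum fun t ht => sub_le_sub_right (Finset.inf'_le _ ht) _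
  have h2 := ha.sum_le_tsum (Finset.range (k + 1)) fun t _ => sub_nonneg.2 (hc t)
  rw [Finset.sum_const, Finset.card_range, nsmul_eq_mul] at h1
  push_cast at h1
  rw [Real.norm_of_nonneg (sub_nonneg.2 h0), Real.norm_of_nonneg (by positivity), mul_one_div,
    le_div_iff₀ hk']
  linarith

lemma runningMin_isBigO {a : ℕ → ℝ} (h0 : ∀ k, 0 ≤ a k) (ha : Summable a) :
    runningMin a =O[atTop] fun k : ℕ => 1 / (k : ℝ) := by
  simpa using runningMin_sub_isBigO h0 (by simpa using ha)

section Trajectory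

variable {N n : ℕ} {f : Fin n → EuclideanSpace ℝ (Fin N) → ℝ} {lam θ γ L : ℝ}
  {xs : EuclideanSpace ℝ (Fin N)}
  {z : ℕ → EuclideanSpace ℝ (Fin N) × (Fin n → EuclideanSpace ℝ (Fin N))}

lemma summable_of_summable_optimalityGap (hn : 0 < n) (hxs : IsMinOn (objective f) Set.univ xs)
    (h : Summable fun k => optimalityGap f xs (z k)) :
    (∀ i, Summable fun k => ‖∇ (f i) (z k).1 - ∇ (f i) xs‖ ^ 2) ∧
    (∀ i, Summable fun k => ‖(z k).2 i - ∇ (f i) xs‖ ^ 2) ∧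
    Summable fun k => objective f (z k).1 - objective f xs := by
  have hn' : (0 : ℝ) < n := by positivity
  have hF : ∀ k, 0 ≤ objective f (z k).1 - objective f xs := fun k =>
    sub_nonneg.2 (hxs (Set.mem_univ _))
  have key : ∀ k, n * optimalityGap f xs (z k) = ∑ j, ‖∇ (f j) (z k).1 - ∇ (f j) xs‖ ^ 2
      + ∑ j, ‖(z k).2 j - ∇ (f j) xs‖ ^ 2 + n * (objective f (z k).1 - objective f xs) := fun k => by
    unfold optimalityGap
    field_simp
  refine ⟨fun i => (h.mul_left (n : ℝ)).of_nonneg_of_le (fun k => by positivity) fun k => ?_,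
    fun i => (h.mul_left (n : ℝ)).of_nonneg_of_le (fun k => by positivity) fun k => ?_,
    h.of_nonneg_of_le hF fun k => ?_⟩
  · rw [key, add_assoc]
    have := hF k
    exact (Finset.single_le_sum (f := fun j => ‖∇ (f j) (z k).1 - ∇ (f j) xs‖ ^ 2)
      (fun j _ => by positivity) (Finset.mem_univ i)).trans
      (le_add_of_nonneg_right (by positivity))
  · rw [key, add_right_comm]
    have := hF k
    exact (Finset.single_le_sum (f := fun j => ‖(z k).2 j - ∇ (f j) xs‖ ^ 2)
      (fun j _ => by positivity) (Finset.mem_univ i)).trans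
      (le_add_of_nonneg_left (by positivity))
  · exact le_add_of_nonneg_left (by positivity)

lemma tendsto_of_summable_norm_sub_sq {E : Type*} [NormedAddCommGroup E] {u : ℕ → E} {v : E}
    (h : Summable fun k => ‖u k - v‖ ^ 2) : Tendsto u atTop (𝓝 v) := by
  have h1 := h.tendsto_atTop_zero.sqrt
  simp only [Real.sqrt_sq (norm_nonneg _), Real.sqrt_zero] at h1
  exact tendsto_iff_norm_sub_tendsto_zero.2 h1

/-- Once the residual quantities vanish, convergence of the Lyapunov function amounts to convergence
of the distance to the minimizer. -/
lemma tendsto_norm_sub_of_tendsto_lyapunov (hn : 0 < n) (hL : 0 < L)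
    (hf : ∀ i, IsConvexSmooth L (f i)) (hxs : IsMinOn (objective f) Set.univ xs)
    (hg : ∀ i, Tendsto (fun k => ∇ (f i) (z k).1) atTop (𝓝 (∇ (f i) xs)))
    (hy : ∀ i, Tendsto (fun k => (z k).2 i) atTop (𝓝 (∇ (f i) xs)))
    (hF : Tendsto (fun k => objective f (z k).1) atTop (𝓝 (objective f xs)))
    (hV : ∃ l, Tendsto (fun k => lyapunov f lam θ γ xs (z k)) atTop (𝓝 l)) :
    ∃ l, Tendsto (fun k => ‖(z k).1 - xs‖) atTop (𝓝 l) := by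
  obtain ⟨l, hl⟩ := hV
  set yb := fun k => (1 / (n : ℝ)) • ∑ j, (z k).2 j
  have hyb : Tendsto yb atTop (𝓝 0) := by
    have := (tendsto_finsetSum Finset.univ fun i _ => hy i).const_smul (1 / (n : ℝ))
    rwa [sum_gradient_eq_zero hn hf hxs, smul_zero] at this
  have hFy : Tendsto (fun k => objective f ((z k).1 + lam • yb k)) atTop (𝓝 (objective f xs)) := by
    have hs : Tendsto (fun k => lam • yb k) atTop (𝓝 0) := by simpa using hyb.const_smul lam
    have h1 : Tendsto (fun k => objective f (z k).1
        + (1 / (n : ℝ)) * ∑ i, inner ℝ (∇ (f i) (z k).1) (lam • yb k)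
        + L / 2 * ‖lam • yb k‖ ^ 2) atTop (𝓝 (objective f xs)) := by
      have h2 := (hF.add ((tendsto_finsetSum Finset.univ fun i _ =>
        (hg i).inner (𝕜 := ℝ) hs).const_mul (1 / (n : ℝ)))).add ((hs.norm.pow 2).const_mul (L / 2))
      simpa using h2
    exact tendsto_of_tendsto_of_tendsto_of_le_of_le tendsto_const_nhds h1
      (fun k => hxs (Set.mem_univ _)) fun k => objective_le_add_inner_add hn hL hf _ _
  have hB : Tendsto (fun k => ∑ j, ‖(z k).2 j - ∇ (f j) xs‖ ^ 2) atTop (𝓝 0) := by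
    have := tendsto_finsetSum Finset.univ fun i _ => (((hy i).sub_const (∇ (f i) xs)).norm.pow 2)
    simpa using this
  have hsq : Tendsto (fun k => ‖(z k).1 - (lam * (n - θ)) • yb k - xs‖ ^ 2) atTop (𝓝 l) := by
    have := (hl.sub ((hFy.sub_const (objective f xs)).const_mul (2 * lam * (n - θ)))).sub
      (hB.const_mul γ)
    simp only [sub_self, mul_zero, sub_zero] at this
    refine this.congr fun k => ?_
    unfold lyapunov
    ring
  have hroot := hsq.sqrt
  simp only [Real.sqrt_sq (norm_nonneg _)] at hroot
  have hdiff : Tendsto (fun k => ‖(z k).1 - xs‖ - ‖(z k).1 - (lam * (n - θ)) • yb k - xs‖)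
      atTop (𝓝 0) := by
    have h0 : Tendsto (fun k => ‖(lam * (n - θ)) • yb k‖) atTop (𝓝 0) := by
      simpa using (hyb.const_smul (lam * (n - θ))).norm
    refine squeeze_zero_norm (fun k => ?_) h0
    refine (abs_norm_sub_norm_le _ _).trans_eq (congrArg _ ?_)
    abel
  exact ⟨_, (hdiff.add hroot).congr fun k => by ring⟩

/-- Along a trajectory whose residuals are summable and whose Lyapunov functions relative to a dense
sequence of minimizers converge, the iterates converge to a minimizer. -/
lemma exists_isMinOn_and_tendsto (hn : 0 < n) (hL : 0 < L) (hf : ∀ i, IsConvexSmooth L (f i))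
    (d : ℕ → {p | IsMinOn (objective f) Set.univ p}) (hd : DenseRange d)
    (hgap : Summable fun k => optimalityGap f (d 0) (z k))
    (hV : ∀ j, ∃ l, Tendsto (fun k => lyapunov f lam θ γ (d j) (z k)) atTop (𝓝 l)) :
    ∃ p, IsMinOn (objective f) Set.univ p ∧ Tendsto (fun k => (z k).1) atTop (𝓝 p) := by
  obtain ⟨h1, h2, h3⟩ := summable_of_summable_optimalityGap hn (d 0).2 hgap
  have hF : Tendsto (fun k => objective f (z k).1) atTop (𝓝 (objective f (d 0))) :=
    tendsto_sub_nhds_zero_iff.1 h3.tendsto_atTop_zero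
  refine exists_tendsto_of_tendsto_norm_sub _ d hd (fun j => ?_) fun p φ hφ hp => ?_
  · have hgrad := gradient_eq_of_isMinOn hn hL hf (d 0).2 (d j).2
    have hval : objective f (d 0) = objective f (d j) :=
      le_antisymm ((d 0).2 (Set.mem_univ _)) ((d j).2 (Set.mem_univ _))
    refine tendsto_norm_sub_of_tendsto_lyapunov hn hL hf (d j).2 (fun i => ?_) (fun i => ?_)
      (hval ▸ hF) (hV j)
    · exact hgrad i ▸ tendsto_of_summable_norm_sub_sq (h1 i)
    · exact hgrad i ▸ tendsto_of_summable_norm_sub_sq (h2 i)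
  · have hval : objective f p = objective f (d 0) :=
      tendsto_nhds_unique (((objective_continuous hf).tendsto p).comp hp)
        (hF.comp hφ.tendsto_atTop)
    intro q hq
    change objective f p ≤ objective f q
    rw [hval]
    exact (d 0).2 hq

end Trajectory

/-! ### Convergence of SVAG -/

theorem theorem2 {N n : ℕ} (hn : 0 < n) {L : ℝ} (hL : 0 < L)
    (f : Fin n → EuclideanSpace ℝ (Fin N) → ℝ)
    (hf : ∀ i, IsConvexSmooth L (f i))
    (hsol : ∃ x, IsMinOn (objective f) Set.univ x)
    (lam θ : ℝ) (hlam : 0 < lam) (hθ : θ ≤ n)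
    (hstep : lam < stepSizeBound n θ L)
    {Ω : Type*} [MeasurableSpace Ω] (P : Measure Ω) [IsProbabilityMeasure P]
    (s : ℕ → Ω → Fin n) (hs : IsUniformSampling P s)
    (x0 : EuclideanSpace ℝ (Fin N)) (y0 : Fin n → EuclideanSpace ℝ (Fin N))
    (x : ℕ → Ω → EuclideanSpace ℝ (Fin N))
    (hx : ∀ k ω, x k ω = (svag f lam θ x0 y0 (fun m => s m ω) k).1)
    (y : Fin n → ℕ → Ω → EuclideanSpace ℝ (Fin N))
    (hy : ∀ i k ω, y i k ω = (svag f lam θ x0 y0 (fun m => s m ω) k).2 i) :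
    (∃ xstar : Ω → EuclideanSpace ℝ (Fin N), Measurable xstar ∧
      ∀ᵐ ω ∂P,
        IsMinOn (objective f) Set.univ (xstar ω) ∧
        Tendsto (fun k => x k ω) atTop (𝓝 (xstar ω)) ∧
        (∀ i, Tendsto (fun k => y i k ω) atTop (𝓝 (∇ (f i) (xstar ω)))) ∧
        (∀ i, runningMin (fun t => ‖∇ (f i) (x t ω) - ∇ (f i) (xstar ω)‖ ^ 2)
          =O[atTop] fun k : ℕ => 1 / (k : ℝ)) ∧
        (∀ i, runningMin (fun t => ‖y i t ω - ∇ (f i) (xstar ω)‖ ^ 2)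
          =O[atTop] fun k : ℕ => 1 / (k : ℝ)) ∧
        (fun k => runningMin (fun t => objective f (x t ω)) k - objective f (xstar ω))
          =O[atTop] fun k : ℕ => 1 / (k : ℝ)) ∧
    stepSizeBound n 1 L = 1 / (2 * L) ∧ stepSizeBound n n L = 1 / (2 * L) := by
  refine ⟨?_, stepSizeBound_one n L, stepSizeBound_self n L⟩
  obtain ⟨a, b, ha, hb, hab, hcross⟩ := exists_cross_term_bound ((θ - 1) / n)
  obtain ⟨γ, δ, hγ, hδ, hδ2, hB, hA⟩ :=
    exists_lyapunov_constants hn hL hlam hθ hstep ha hb hab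
  set z : ℕ → Ω → EuclideanSpace ℝ (Fin N) × (Fin n → EuclideanSpace ℝ (Fin N)) :=
    fun k ω => svag f lam θ x0 y0 (fun m => s m ω) k
  have : Nonempty {p | IsMinOn (objective f) Set.univ p} :=
    let ⟨p, hp⟩ := hsol
    ⟨⟨p, hp⟩⟩
  set d := TopologicalSpace.denseSeq {p | IsMinOn (objective f) Set.univ p}
  have hd : DenseRange d := TopologicalSpace.denseRange_denseSeq _
  have hae : ∀ᵐ ω ∂P, ∀ j, Summable (fun k => δ * optimalityGap f (d j) (z k ω)) ∧
      ∃ l, Tendsto (fun k => lyapunov f lam θ γ (d j) (z k ω)) atTop (𝓝 l) :=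
    ae_all_iff.2 fun j => ae_summable_and_tendsto_of_average_le hs (svagStep f lam θ) (x0, y0) z
      (fun _ => rfl) (fun _ _ => rfl) _ (fun u => δ * optimalityGap f (d j) u)
      (lyapunov_nonneg hlam hθ hγ (d j).2)
      (fun u => mul_nonneg hδ.le (optimalityGap_nonneg (d j).2 u))
      (sum_lyapunov_svagStep_le hn hL hf hlam hθ (d j).2 ha hb (hcross _) hδ.le hδ2 hB hA)
  have hgap : ∀ᵐ ω ∂P, Summable fun k => optimalityGap f (d 0) (z k ω) :=
    hae.mono fun ω hω => (summable_mul_left_iff hδ.ne').1 (hω 0).1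
  have hconv : ∀ᵐ ω ∂P, ∃ p, IsMinOn (objective f) Set.univ p ∧
      Tendsto (fun k => x k ω) atTop (𝓝 p) := by
    filter_upwards [hae, hgap] with ω hω hω'
    simp_rw [hx]
    exact exists_isMinOn_and_tendsto hn hL hf d hd hω' fun j => (hω j).2
  have hmeas : ∀ k, Measurable (x k) := fun k => by
    obtain ⟨φ, hφ⟩ := exists_eq_comp_sampledPrefix (svagStep f lam θ) (x0, y0) z
      (fun _ => rfl) (fun _ _ => rfl) k
    have : x k = (fun τ => (φ τ).1) ∘ sampledPrefix s k :=
      funext fun ω => by rw [hx, Function.comp, ← hφ]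
    rw [this]
    exact (measurable_of_finite _).comp (measurable_sampledPrefix hs.measurable k)
  obtain ⟨xstar, hxm, hxlim⟩ := measurable_limit_of_tendsto_metrizable_ae
    (fun k => (hmeas k).aemeasurable) (hconv.mono fun ω ⟨p, hp⟩ => ⟨p, hp.2⟩)
  refine ⟨xstar, hxm, ?_⟩
  filter_upwards [hconv, hxlim, hgap] with ω ⟨p, hp, hpx⟩ hω hgapω
  obtain rfl := tendsto_nhds_unique hpx hω
  -- The component gradients and the optimal value do not depend on the minimizer.
  have hgrad := gradient_eq_of_isMinOn hn hL hf (d 0).2 hp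
  have hval : objective f (d 0) = objective f (xstar ω) :=
    le_antisymm ((d 0).2 (Set.mem_univ _)) (hp (Set.mem_univ _))
  obtain ⟨h1, h2, h3⟩ := summable_of_summable_optimalityGap hn (d 0).2 hgapω
  simp only [hgrad, hval] at h1 h2 h3
  simp_rw [hx, hy] at hω ⊢
  exact ⟨hp, hω, fun i => tendsto_of_summable_norm_sub_sq (h2 i),
    fun i => runningMin_isBigO (fun k => by positivity) (h1 i),
    fun i => runningMin_isBigO (fun k => by positivity) (h2 i),
    runningMin_sub_isBigO (fun k => hp (Set.mem_univ _)) h3⟩
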